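/- **Setting.** An episodic MDP $M$ with countable state space $\mathcal X$, countable action space $\mathcal A$ and horizon $H\ge 1$ consists of an initial law $P_0\in\Delta(\mathcal X)$, transitions $P_h:\mathcal X\times\mathcal A\to\Delta(\mathcal X)$ and reward laws $R_h:\mathcal X\times\mathcal A\to\Delta([0,1])$. A policy $\pi=(\pi_1,\dots,\pi_H)$, $\pi_h:\mathcal X\to\Delta(\mathcal A)$, generates a trajectory by $x_1\sim P_0$, $a_h\sim\pi_h(x_h)$, $r_h\sim R_h(x_h,a_h)$, $x_{h+1}\sim P_h(x_h,a_h)$; write $J^M(\pi)=\mathbb E^{M,\pi}\big[\sum_{h=1}^H r_h\big]$. Rewards are *normalized* if, under every policy, $\sum_{h=1}^H r_h\in[0,1]$ almost surely. An algorithm with $T$ episodes chooses (possibly at random) in each episode a policy depending on the previous policies and trajectories, observes the resulting trajectory, and after $T$ episodes outputs a policy $\hat\pi$; its risk in $M$ is $\sup_\pi J^M(\pi)-J^M(\hat\pi)$. For a class $\mathcal M$ of MDPs, $\mathrm{comp}(\mathcal M,\varepsilon,\delta)\in\{0,1,2,\dots\}\cup\{\infty\}$ is the least $T$ for which there is an algorithm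 with $T$ episodes that, for every $M\in\mathcal M$, has risk at most $\varepsilon$ with probability at least $1-\delta$. Given a base MDP $M_{\mathrm{lat}}$ with state space $\mathcal S$, an emission process $\psi=(\psi_h:\mathcal S\to\Delta(\mathcal X))_{h=1}^H$ is *decodable* if for every $h$ and $s\ne s'$ the supports of $\psi_h(s)$ and $\psi_h(s')$ are disjoint; $\phi:\mathcal X\to\mathcal S$ is its decoder if $\phi(x)=s$ for all $h$, $s$ and $x\in\operatorname{supp}\psi_h(s)$. The latent-dynamics MDP $\langle\!\langle M_{\mathrm{lat}},\psi\rangle\!\rangle$ has states $x_h\sim\psi_h(s_h)$, where the unobserved $s_h$ evolves and yields rewards as in $M_{\mathrm{lat}}$. For a set $\Phi$ of maps $\mathcal X\to\mathcal S$ let $\langle\!\langle \mathcal M_{\mathrm{lat}},\Phi\rangle\!\rangle$ be the class of all $\langle\!\langle M_{\mathrm{lat}},\psi\rangle\!\rangle$ with $M_{\mathrm{lat}}\in\mathcal M_{\mathrm{lat}}$ and $\psi$ decodable with decoder in $\Phi$. **Theorem (Impossibility of statistical modularity).** There are absolute constants $c,C,\kappa>0$ such that for every integer $N\ge4$ there exist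 finite sets $\mathcal S,\mathcal X$, a horizon $H\ge1$, a set $\Phi$ of decoders $\mathcal X\to\mathcal S$ with $|\Phi|=N$, and a single base MDP $M_{\mathrm{lat}}$ with state space $\mathcal S$ and horizon $H$, such that $H\le C\log N$, $|\mathcal S|=|\mathcal X|\le N^2$, $|\mathcal A|=2$, $M_{\mathrm{lat}}$ and all MDPs in $\langle\!\langle \{M_{\mathrm{lat}}\},\Phi\rangle\!\rangle$ have normalized rewards, and 1. $\mathrm{comp}(\{M_{\mathrm{lat}}\},\varepsilon,\delta)=0$ for all $\varepsilon,\delta>0$; 2. $\mathrm{comp}(\langle\!\langle \{M_{\mathrm{lat}}\},\Phi\rangle\!\rangle,c,c)\ \ge\ \kappa\,\dfrac{N}{\log N}$. -/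

import Mathlib

open MeasureTheory ProbabilityTheory
open scoped ENNReal unitInterval

namespace LatentRL

/-- An episodic finite-horizon Markov decision process over a countable state space `X` and a
countable action space `A`, with horizon `H = L + 1`.  The layers `1, …, H` are indexed by
`Fin (L + 1)`.  `init` is the distribution of the first state, `P h x a` is the law of the state in
layer `h.succ` given state `x` and action `a` in layer `h.castSucc`, and `R h x a` is the law of the
reward in layer `h`, a probability measure on `[0,1]`.  (A transition out of the last layer would
have no influence on the trajectory, so there is none.) -/
structure MDP (L : ℕ) (X A : Type) where
  init : PMF X
  P : Fin L → X → A → PMF X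
  R : Fin (L + 1) → X → A → ProbabilityMeasure I

/-- Randomized non-stationary (Markov) policies. -/
def Policy (L : ℕ) (X A : Type) : Type := Fin (L + 1) → X → PMF A

/-- The sigma-algebra on policies generated by the evaluations `π ↦ π_h(a ∣ x)`. -/
instance Policy.instMeasurableSpace (L : ℕ) (X A : Type) : MeasurableSpace (Policy L X A) :=
  MeasurableSpace.comap
    (fun (π : Policy L X A) (h : Fin (L + 1)) (x : X) (a : A) => (π h x) a) inferInstance

/-- Trajectories `(x_1, a_1, r_1), …, (x_H, a_H, r_H)`. -/
abbrev Traj (L : ℕ) (X A : Type) : Type := Fin (L + 1) → X × A × I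

/-- The probability that a Markov chain with initial law `init`, policy `π` and transitions `P`
produces the states `z.1` and the actions `z.2`. -/
noncomputable def pathWeight {L : ℕ} {X A : Type} (init : PMF X) (P : Fin L → X → A → PMF X)
    (π : Fin (L + 1) → X → PMF A) (z : (Fin (L + 1) → X) × (Fin (L + 1) → A)) : ℝ≥0∞ :=
  init (z.1 0) * (∏ h : Fin (L + 1), π h (z.1 h) (z.2 h)) *
    ∏ h : Fin L, P h (z.1 h.castSucc) (z.2 h.castSucc) (z.1 h.succ)

/-- The law of the trajectory that results from `x_1 ∼ init`, `a_h ∼ π_h(x_h)`,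
`r_h ∼ R_h(x_h, a_h)`, `x_{h+1} ∼ P_h(x_h, a_h)`: the states and actions have the law `pathWeight`,
and given them the rewards are independent with laws `R_h(x_h, a_h)`. -/
noncomputable def MDP.trajLaw {L : ℕ} {X A : Type} [MeasurableSpace X] [MeasurableSpace A]
    (M : MDP L X A) (π : Policy L X A) : Measure (Traj L X A) :=
  Measure.sum fun z : (Fin (L + 1) → X) × (Fin (L + 1) → A) =>
    pathWeight M.init M.P π z •
      (Measure.pi fun h => (M.R h (z.1 h) (z.2 h) : Measure I)).map
        (fun (r : Fin (L + 1) → I) (h : Fin (L + 1)) => (z.1 h, z.2 h, r h))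

theorem tsum_pathWeight {X A : Type} : ∀ {L : ℕ} (init : PMF X) (P : Fin L → X → A → PMF X)
    (π : Fin (L + 1) → X → PMF A), ∑' z, pathWeight init P π z = 1
  | 0, init, P, π => by
    have e : ∑' z : (Fin 1 → X) × (Fin 1 → A), pathWeight init P π z
        = ∑' w : X × A, init w.1 * π 0 w.1 w.2 := by
      rw [← ((Equiv.funUnique (Fin 1) X).prodCongr (Equiv.funUnique (Fin 1) A)).tsum_eq]
      refine tsum_congr fun z => ?_
      simp [pathWeight]
    rw [e, ENNReal.tsum_prod (f := fun x a => init x * π 0 x a)]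
    simp [ENNReal.tsum_mul_left, PMF.tsum_coe]
  | L + 1, init, P, π => by
    have e : ∑' z : (Fin (L + 2) → X) × (Fin (L + 2) → A), pathWeight init P π z
        = ∑' w : (X × A) × ((Fin (L + 1) → X) × (Fin (L + 1) → A)),
            (init w.1.1 * π 0 w.1.1 w.1.2) *
              pathWeight (P 0 w.1.1 w.1.2) (fun h => P h.succ) (fun h => π h.succ) w.2 := by
      rw [← (((Equiv.prodProdProdComm X A (Fin (L + 1) → X) (Fin (L + 1) → A)).trans
        ((Fin.consEquiv fun _ : Fin (L + 2) => X).prodCongr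
          (Fin.consEquiv fun _ : Fin (L + 2) => A)))).tsum_eq]
      refine tsum_congr fun w => ?_
      obtain ⟨⟨x, a⟩, ⟨xs, as⟩⟩ := w
      simp only [pathWeight, Fin.consEquiv, Equiv.trans_apply, Equiv.prodProdProdComm_apply,
        Equiv.prodCongr_apply, Prod.map, Equiv.coe_fn_mk, Fin.cons_zero, Fin.prod_univ_succ,
        Fin.cons_succ, Fin.castSucc_zero, Fin.castSucc_succ]
      ring
    rw [e, ENNReal.tsum_prod (f := fun (w : X × A) z => (init w.1 * π 0 w.1 w.2) *
      pathWeight (P 0 w.1 w.2) (fun h => P h.succ) (fun h => π h.succ) z)]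
    simp_rw [ENNReal.tsum_mul_left, tsum_pathWeight, mul_one]
    rw [ENNReal.tsum_prod (f := fun x a => init x * π 0 x a)]
    simp [ENNReal.tsum_mul_left, PMF.tsum_coe]

theorem measurable_rewards {L : ℕ} {X A : Type} [MeasurableSpace X] [MeasurableSpace A]
    (z : (Fin (L + 1) → X) × (Fin (L + 1) → A)) :
    Measurable (fun (r : Fin (L + 1) → I) (h : Fin (L + 1)) => (z.1 h, z.2 h, r h)) :=
  measurable_pi_lambda _ fun h => by fun_prop

instance MDP.isProbabilityMeasure_trajLaw {L : ℕ} {X A : Type} [MeasurableSpace X]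
    [MeasurableSpace A] (M : MDP L X A) (π : Policy L X A) :
    IsProbabilityMeasure (M.trajLaw π) := by
  constructor
  rw [MDP.trajLaw, Measure.sum_apply _ MeasurableSet.univ, ← tsum_pathWeight M.init M.P π]
  refine tsum_congr fun z => ?_
  rw [Measure.smul_apply, Measure.map_apply (measurable_rewards z) MeasurableSet.univ]
  simp

theorem measurable_policy_apply {L : ℕ} {X A : Type} (h : Fin (L + 1)) (x : X) (a : A) :
    Measurable fun π : Policy L X A => (π h x) a := by
  have e : Measurable
      (fun (π : Policy L X A) (h : Fin (L + 1)) (x : X) (a : A) => (π h x) a) :=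
    comap_measurable _
  exact measurable_pi_iff.1 (measurable_pi_iff.1 (measurable_pi_iff.1 e h) x) a

/-- The law of the trajectory as a Markov kernel in the policy. -/
noncomputable def MDP.trajKernel {L : ℕ} {X A : Type} [MeasurableSpace X] [MeasurableSpace A]
    [Countable X] [Countable A] (M : MDP L X A) : Kernel (Policy L X A) (Traj L X A) where
  toFun := M.trajLaw
  measurable' := by
    refine Measure.measurable_of_measurable_coe _ fun s hs => ?_
    simp only [MDP.trajLaw, Measure.sum_apply _ hs, Measure.smul_apply, smul_eq_mul, pathWeight]
    refine Measurable.tsum fun z => ?_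
    refine Measurable.mul_const (Measurable.mul_const (Measurable.const_mul ?_ _) _) _
    exact Finset.measurable_fun_prod _ fun h _ => measurable_policy_apply _ _ _

instance MDP.isMarkovKernel_trajKernel {L : ℕ} {X A : Type} [MeasurableSpace X]
    [MeasurableSpace A] [Countable X] [Countable A] (M : MDP L X A) :
    IsMarkovKernel M.trajKernel :=
  ⟨fun π => M.isProbabilityMeasure_trajLaw π⟩

/-- The expected total reward `J^M(π)`. -/
noncomputable def MDP.value {L : ℕ} {X A : Type} [MeasurableSpace X] [MeasurableSpace A]
    (M : MDP L X A) (π : Policy L X A) : ℝ :=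
  ∫ τ, ∑ h, ((τ h).2.2 : ℝ) ∂M.trajLaw π

/-- The risk of an output policy: the optimal expected total reward minus that of the policy.
(The values lie in `[0, L + 1]`, so the supremum is a genuine one.) -/
noncomputable def MDP.risk {L : ℕ} {X A : Type} [MeasurableSpace X] [MeasurableSpace A]
    (M : MDP L X A) (π : Policy L X A) : ℝ :=
  (⨆ π' : Policy L X A, M.value π') - M.value π

/-- The total reward lies in `[0,1]` almost surely, under every policy. -/
def MDP.RewardsNormalized {L : ℕ} {X A : Type} [MeasurableSpace X] [MeasurableSpace A]
    (M : MDP L X A) : Prop :=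
  ∀ π : Policy L X A, ∀ᵐ τ ∂M.trajLaw π, ∑ h, ((τ h).2.2 : ℝ) ∈ Set.Icc (0 : ℝ) 1

/-- What a learner has seen after `t` episodes: the policies it executed and the resulting
trajectories. -/
abbrev History (L : ℕ) (X A : Type) (t : ℕ) : Type := Fin t → Policy L X A × Traj L X A

/-- A (randomized, adaptive) online learning algorithm with `T` episodes: it selects the policy of
each episode from the history of the earlier ones, and at the end outputs a policy.  (What `select`
does after the first `T` episodes is irrelevant.) -/
structure Algorithm (L : ℕ) (X A : Type) [MeasurableSpace X] [MeasurableSpace A] (T : ℕ) where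
  select : (t : ℕ) → Kernel (History L X A t) (Policy L X A)
  output : Kernel (History L X A T) (Policy L X A)
  markov_select : ∀ t, IsMarkovKernel (select t)
  markov_output : IsMarkovKernel output

attribute [instance] Algorithm.markov_select Algorithm.markov_output

/-- Appending an episode to a history. -/
def History.snoc {L : ℕ} {X A : Type} {t : ℕ}
    (p : History L X A t × (Policy L X A × Traj L X A)) : History L X A (t + 1) :=
  Fin.snoc (α := fun _ => Policy L X A × Traj L X A) p.1 p.2

theorem History.measurable_snoc {L : ℕ} {X A : Type} [MeasurableSpace X] [MeasurableSpace A]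
    {t : ℕ} : Measurable (History.snoc (L := L) (X := X) (A := A) (t := t)) := by
  refine measurable_pi_lambda _ fun i => ?_
  refine Fin.lastCases ?_ (fun j => ?_) i
  · simpa [History.snoc] using measurable_snd
  · simp only [History.snoc, Fin.snoc_castSucc]
    exact (measurable_pi_apply j).comp measurable_fst

/-- The law of the first `t` episodes when the algorithm interacts with `M`: in each episode a
policy is drawn from `select`, and then a trajectory from the law of that policy in `M`. -/
noncomputable def Algorithm.historyLaw {L : ℕ} {X A : Type} [MeasurableSpace X]
    [MeasurableSpace A] [Countable X] [Countable A] {T : ℕ} (alg : Algorithm L X A T)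
    (M : MDP L X A) : (t : ℕ) → Measure (History L X A t)
  | 0 => Measure.dirac Fin.elim0
  | t + 1 => ((alg.historyLaw M t) ⊗ₘ
      (alg.select t ⊗ₖ Kernel.prodMkLeft (History L X A t) M.trajKernel)).map History.snoc

instance Algorithm.isProbabilityMeasure_historyLaw {L : ℕ} {X A : Type} [MeasurableSpace X]
    [MeasurableSpace A] [Countable X] [Countable A] {T : ℕ} (alg : Algorithm L X A T)
    (M : MDP L X A) : (t : ℕ) → IsProbabilityMeasure (alg.historyLaw M t)
  | 0 => by rw [Algorithm.historyLaw]; infer_instance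
  | t + 1 => by
    have := alg.isProbabilityMeasure_historyLaw M t
    rw [Algorithm.historyLaw]
    exact Measure.isProbabilityMeasure_map History.measurable_snoc.aemeasurable

/-- The law of the output policy after `T` episodes of interaction with `M`. -/
noncomputable def Algorithm.outputLaw {L : ℕ} {X A : Type} [MeasurableSpace X]
    [MeasurableSpace A] [Countable X] [Countable A] {T : ℕ} (alg : Algorithm L X A T)
    (M : MDP L X A) : Measure (Policy L X A) :=
  (alg.historyLaw M T).bind alg.output

/-- The class `𝓜` can be learned up to `ε`-optimality with `T` episodes, with failure probability
at most `δ`: a single algorithm succeeds on every member of the class. -/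
def LearnableWith {L : ℕ} {X A : Type} [MeasurableSpace X] [MeasurableSpace A] [Countable X]
    [Countable A] (𝓜 : Set (MDP L X A)) (ε δ : ℝ) (T : ℕ) : Prop :=
  ∃ alg : Algorithm L X A T, ∀ M ∈ 𝓜,
    ENNReal.ofReal (1 - δ) ≤ alg.outputLaw M {π | M.risk π ≤ ε}

/-- The (minimax) sample complexity of a class of MDPs: the least number of episodes with which it
can be learned, `∞` if there is none. -/
noncomputable def sampleComplexity {L : ℕ} {X A : Type} [MeasurableSpace X] [MeasurableSpace A]
    [Countable X] [Countable A] (𝓜 : Set (MDP L X A)) (ε δ : ℝ) : ℕ∞ :=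
  ⨅ (T : ℕ) (_ : LearnableWith 𝓜 ε δ T), (T : ℕ∞)

/-- Emission processes `ψ_h : S → Δ(X)`, one for each layer. -/
abbrev Emission (L : ℕ) (S X : Type) : Type := Fin (L + 1) → S → PMF X

/-- In each layer, distinct latent states emit observations from disjoint sets. -/
def Emission.IsDecodable {L : ℕ} {S X : Type} (ψ : Emission L S X) : Prop :=
  ∀ h, ∀ s s' : S, s' ≠ s → (ψ h s).support ∩ (ψ h s').support = ∅

/-- `φ` is the decoder `ψ⁻¹`: in each layer it maps each observation that `s` can emit to `s`. -/
def Emission.HasDecoder {L : ℕ} {S X : Type} (ψ : Emission L S X) (φ : X → S) : Prop :=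
  ∀ h, ∀ s : S, ∀ x ∈ (ψ h s).support, φ x = s

/-- The latent-dynamics MDP with base MDP `M` and emission process `ψ`, where `φ` is the decoder of
`ψ`: the latent state is decoded from the observation, evolves and yields rewards as in `M`, and
the next latent state emits the next observation. -/
noncomputable def latentDynamics {L : ℕ} {S X A : Type} (M : MDP L S A) (ψ : Emission L S X)
    (φ : X → S) : MDP L X A where
  init := M.init.bind (ψ 0)
  P h x a := (M.P h (φ x) a).bind (ψ h.succ)
  R h x a := M.R h (φ x) a

/-- The class of latent-dynamics MDPs induced by a class `𝓜` of base MDPs and a class `Φ` of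
decoders: the base MDP is in `𝓜`, and the emission process is decodable with decoder in `Φ`. -/
def latentDynamicsClass {L : ℕ} {S X A : Type} (𝓜 : Set (MDP L S A)) (Φ : Set (X → S)) :
    Set (MDP L X A) :=
  {M' | ∃ M ∈ 𝓜, ∃ ψ : Emission L S X, ψ.IsDecodable ∧
    ∃ φ ∈ Φ, ψ.HasDecoder φ ∧ M' = latentDynamics M ψ φ}

end LatentRL

/-!
The base MDP is a combination lock whose code is drawn anew in each episode. A uniformly random
binary word `r` of length `k` is shown, the learner enters a word `w` digit by digit, and the reward
is `1` if `w = r`. A state is the pair of `r` and the word entered so far, so that one knows what to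
do in every state, and no episode is needed.

The decoder with key `i` replaces the code `r` by `r + i`, so in the observed MDP the word to be
entered is `w = r + i` with an unknown key `i`. The law of the observed states and actions does not
depend on `i`; only the reward in the last layer does. Hence an episode with final state `(r, w)`
tests the single key `w - r`, and the learner faces a search for one among `2 ^ k` keys.

For the lower bound, each lock is compared with the lock without rewards. By
`lintegral_trajLaw_lockMDP_le` the trajectory laws differ by at most the probability that the policy
tests the key, and `Algorithm.lintegral_historyLaw_le` adds this up over the episodes. Under every
policy the probabilities of testing the single keys sum to one (`sum_winProb_keySet`). Summing over
all keys therefore bounds `2 ^ k` times the success probability by the number of episodes plus one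
(for the output policy), up to constants; this is `episodes_lower_bound`.

With `2 ^ k` the largest power of two up to `N` this gives an order of `N` episodes. The decoder set
is filled up to `N` elements with arbitrary maps, which only enlarges the class. Rewards remain
normalized because only the last layer has any.
-/

namespace LatentRL

/-! ### Deterministic rewards -/

/-- A product of Dirac measures is the Dirac measure at the tuple of the atoms. -/
theorem pi_dirac_eq_dirac {ι : Type} [Fintype ι] {E : ι → Type} [∀ i, MeasurableSpace (E i)]
    (r : ∀ i, E i) :
    Measure.pi (fun i => (Measure.dirac (r i) : Measure (E i))) = Measure.dirac r := by
  classical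
  refine Measure.pi_eq fun s hs => ?_
  rw [Measure.dirac_apply' _ (MeasurableSet.univ_pi hs)]
  simp only [Measure.dirac_apply' _ (hs _), Set.indicator_apply, Pi.one_apply,
    Finset.prod_ite_zero, Finset.prod_const_one, Set.mem_univ_pi, Finset.mem_univ, true_imp_iff]

section Deterministic

variable {L : ℕ} {X A : Type}

/-- The trajectory along the states `z.1` and the actions `z.2` when the rewards are the
deterministic function `ρ` of layer, state and action. -/
def rewardedPath (ρ : Fin (L + 1) → X → A → I) (z : (Fin (L + 1) → X) × (Fin (L + 1) → A)) :
    Traj L X A :=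
  fun h => (z.1 h, z.2 h, ρ h (z.1 h) (z.2 h))

theorem totalReward_rewardedPath {ρ : Fin (L + 1) → X → A → I}
    (hρ : ∀ h, h ≠ Fin.last L → ∀ x a, ρ h x a = 0)
    (z : (Fin (L + 1) → X) × (Fin (L + 1) → A)) :
    ∑ h, ((rewardedPath ρ z h).2.2 : ℝ) =
      ρ (Fin.last L) (z.1 (Fin.last L)) (z.2 (Fin.last L)) := by
  rw [Finset.sum_eq_single (Fin.last L)]
  · rfl
  · intro h _ hh
    simp [rewardedPath, hρ h hh]
  · simp

variable [MeasurableSpace X] [MeasurableSpace A] {M : MDP L X A} {ρ : Fin (L + 1) → X → A → I}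

theorem MDP.trajLaw_of_deterministic
    (hR : ∀ h x a, (M.R h x a : Measure I) = Measure.dirac (ρ h x a)) (π : Policy L X A) :
    M.trajLaw π =
      Measure.sum fun z => pathWeight M.init M.P π z • Measure.dirac (rewardedPath ρ z) := by
  rw [MDP.trajLaw]
  congr 1
  funext z
  simp only [hR]
  rw [pi_dirac_eq_dirac fun h => ρ h (z.1 h) (z.2 h)]
  exact congrArg _ (Measure.map_dirac' (measurable_rewards z) _)

theorem MDP.lintegral_trajLaw_of_deterministic
    (hR : ∀ h x a, (M.R h x a : Measure I) = Measure.dirac (ρ h x a)) (π : Policy L X A)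
    {F : Traj L X A → ℝ≥0∞} (hF : Measurable F) :
    ∫⁻ τ, F τ ∂M.trajLaw π = ∑' z, pathWeight M.init M.P π z * F (rewardedPath ρ z) := by
  rw [MDP.trajLaw_of_deterministic hR, lintegral_sum_measure]
  simp only [lintegral_smul_measure, lintegral_dirac' _ hF, smul_eq_mul]

theorem measurable_totalReward :
    Measurable fun τ : Traj L X A => ∑ h, ((τ h).2.2 : ℝ) :=
  Finset.measurable_fun_sum _ fun h _ =>
    measurable_subtype_coe.comp (measurable_snd.comp (measurable_snd.comp (measurable_pi_apply h)))

theorem MDP.rewardsNormalized_of_last [Countable X] [Countable A]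
    (hR : ∀ h x a, (M.R h x a : Measure I) = Measure.dirac (ρ h x a))
    (hρ : ∀ h, h ≠ Fin.last L → ∀ x a, ρ h x a = 0) : M.RewardsNormalized := by
  intro π
  rw [MDP.trajLaw_of_deterministic hR, Measure.ae_sum_iff]
  intro z
  refine Measure.ae_smul_measure ?_ _
  rw [ae_dirac_iff (measurable_totalReward measurableSet_Icc)]
  change ∑ h, _ ∈ _
  rw [totalReward_rewardedPath hρ]
  exact (ρ _ _ _).2

end Deterministic

/-! ### Comparing the histories in two MDPs -/

section Comparison

variable {L : ℕ} {X A : Type} [MeasurableSpace X] [MeasurableSpace A] [Countable X] [Countable A]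
  {T : ℕ}

/-- The expectation of `d (π)`, where `π` is the policy that `alg` selects after `t` episodes in
`M`. -/
noncomputable def Algorithm.selectMean (alg : Algorithm L X A T) (M : MDP L X A)
    (d : Policy L X A → ℝ≥0∞) (t : ℕ) : ℝ≥0∞ :=
  ∫⁻ η, ∫⁻ π, d π ∂alg.select t η ∂alg.historyLaw M t

theorem Algorithm.lintegral_historyLaw_succ (alg : Algorithm L X A T) (M : MDP L X A) (t : ℕ)
    {F : History L X A (t + 1) → ℝ≥0∞} (hF : Measurable F) :
    ∫⁻ η, F η ∂alg.historyLaw M (t + 1) =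
      ∫⁻ η, ∫⁻ π, ∫⁻ τ, F (History.snoc (η, (π, τ))) ∂M.trajLaw π ∂alg.select t η
        ∂alg.historyLaw M t := by
  have hF' : Measurable fun p => F (History.snoc (t := t) p) := hF.comp History.measurable_snoc
  rw [Algorithm.historyLaw, lintegral_map hF History.measurable_snoc,
    Measure.lintegral_compProd hF']
  refine lintegral_congr fun η => ?_
  exact Kernel.lintegral_compProd _ _ _ (hF'.comp measurable_prodMk_left)

/-- If, under every policy, the trajectory laws in `M` and `M₀` differ on test functions with values
in `[0,1]` by at most `d`, then the laws of the first `t` episodes differ by at most the sum of the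
expectations of `d` over the policies executed in `M₀`. -/
theorem Algorithm.lintegral_historyLaw_le (alg : Algorithm L X A T) {M M₀ : MDP L X A}
    {d : Policy L X A → ℝ≥0∞} (hd : Measurable d)
    (hM : ∀ π, ∀ F : Traj L X A → ℝ≥0∞, Measurable F → (∀ τ, F τ ≤ 1) →
      ∫⁻ τ, F τ ∂M.trajLaw π ≤ ∫⁻ τ, F τ ∂M₀.trajLaw π + d π) :
    ∀ (t : ℕ) (F : History L X A t → ℝ≥0∞), Measurable F → (∀ η, F η ≤ 1) →
      ∫⁻ η, F η ∂alg.historyLaw M t ≤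
        ∫⁻ η, F η ∂alg.historyLaw M₀ t + ∑ s ∈ Finset.range t, alg.selectMean M₀ d s
  | 0, F, _, _ => by simp [Algorithm.historyLaw]
  | t + 1, F, hF, h1 => by
    have hF' : Measurable fun p => F (History.snoc (t := t) p) :=
      hF.comp History.measurable_snoc
    -- The conditional expectation of `F` given the first `t` episodes, the last one played in `M`.
    let G : History L X A t → ℝ≥0∞ := fun η =>
      ∫⁻ q, F (History.snoc (η, q)) ∂(alg.select t ⊗ₖ
        Kernel.prodMkLeft (History L X A t) M.trajKernel) η
    have hG : Measurable G := hF'.lintegral_kernel_prod_right'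
    have hG1 : ∀ η, G η ≤ 1 := fun η =>
      (lintegral_mono fun q => h1 _).trans (by simp)
    have hGeq : ∀ η, G η =
        ∫⁻ π, ∫⁻ τ, F (History.snoc (η, (π, τ))) ∂M.trajLaw π ∂alg.select t η := fun η =>
      Kernel.lintegral_compProd _ _ _ (hF'.comp measurable_prodMk_left)
    rw [alg.lintegral_historyLaw_succ M t hF, alg.lintegral_historyLaw_succ M₀ t hF,
      Finset.sum_range_succ, add_comm (∑ s ∈ _, _), ← add_assoc]
    simp only [← hGeq]
    refine (alg.lintegral_historyLaw_le hd hM t G hG hG1).trans ?_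
    gcongr
    rw [Algorithm.selectMean, ← lintegral_add_right _ hd.lintegral_kernel]
    refine lintegral_mono fun η => ?_
    rw [hGeq, ← lintegral_add_right _ hd]
    exact lintegral_mono fun π => hM π _
      (hF'.comp (measurable_prodMk_left.comp measurable_prodMk_left)) fun τ => h1 _

end Comparison

/-! ### The combination lock with a random code -/

/-- Binary words of length `k`, added digitwise modulo `2`. -/
abbrev Code (k : ℕ) : Type := Fin k → Fin 2

/-- A state of the lock: the code shown by the lock, and the word entered so far (padded with
zeros). -/
abbrev LockState (k : ℕ) : Type := Code k × Code k

/-- A uniformly random code is shown and nothing has been entered. -/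
noncomputable def lockInit (k : ℕ) : PMF (LockState k) :=
  (PMF.uniformOfFintype (Code k)).map fun r => (r, 0)

/-- The action in layer `h` is recorded as the `h`-th digit of the word. -/
noncomputable def lockStep (k : ℕ) (h : Fin k) (s : LockState k) (a : Fin 2) :
    PMF (LockState k) :=
  PMF.pure (s.1, Function.update s.2 h a)

open Classical in
/-- Reward `1` in the last layer if the state lies in `W`, and no other reward. -/
noncomputable def lockReward {k : ℕ} (W : Set (LockState k)) (h : Fin (k + 1)) (s : LockState k)
    (_ : Fin 2) : I :=
  if h = Fin.last k ∧ s ∈ W then 1 else 0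

/-- The lock with winning set `W`: a code is shown, `k` digits are entered, and then there is a
reward if the resulting state lies in `W`. -/
noncomputable def lockMDP (k : ℕ) (W : Set (LockState k)) : MDP k (LockState k) (Fin 2) where
  init := lockInit k
  P := lockStep k
  R h s a := ⟨Measure.dirac (lockReward W h s a), inferInstance⟩

/-- The states in which the word entered is the sum of the code shown and the key `i`. -/
def keySet {k : ℕ} (i : Code k) : Set (LockState k) := {s | s.2 = s.1 + i}

/-- The probability that the policy `π` ends in `W`. -/
noncomputable def winProb {k : ℕ} (W : Set (LockState k)) (π : Policy k (LockState k) (Fin 2)) :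
    ℝ≥0∞ :=
  ∑' z, pathWeight (lockInit k) (lockStep k) π z *
    W.indicator (fun _ => (1 : ℝ≥0∞)) (z.1 (Fin.last k))

theorem lockReward_of_ne_last {k : ℕ} (W : Set (LockState k)) (h : Fin (k + 1))
    (hh : h ≠ Fin.last k) (s : LockState k) (a : Fin 2) : lockReward W h s a = 0 := by
  simp [lockReward, hh]

theorem coe_lockReward_last {k : ℕ} (W : Set (LockState k)) (s : LockState k) (a : Fin 2) :
    ENNReal.ofReal (lockReward W (Fin.last k) s a) = W.indicator (fun _ => 1) s := by
  by_cases hs : s ∈ W <;> simp [lockReward, hs]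

theorem measurable_winProb {k : ℕ} (W : Set (LockState k)) : Measurable (winProb W) := by
  unfold winProb pathWeight
  refine Measurable.tsum fun z => ?_
  refine Measurable.mul_const (Measurable.mul_const (Measurable.const_mul ?_ _) _) _
  exact Finset.measurable_fun_prod _ fun h _ => measurable_policy_apply _ _ _

theorem winProb_le_one {k : ℕ} (W : Set (LockState k)) (π : Policy k (LockState k) (Fin 2)) :
    winProb W π ≤ 1 := by
  rw [← tsum_pathWeight (lockInit k) (lockStep k) π]
  refine ENNReal.tsum_le_tsum fun z => ?_
  exact mul_le_of_le_one_right' (Set.indicator_le (fun _ _ => le_rfl) _)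

/-- Every final state is in exactly one of the sets `keySet i`. -/
theorem sum_winProb_keySet {k : ℕ} (π : Policy k (LockState k) (Fin 2)) :
    ∑ i : Code k, winProb (keySet i) π = 1 := by
  unfold winProb
  rw [← Summable.tsum_finsetSum fun _ _ => ENNReal.summable]
  refine (tsum_congr fun z => ?_).trans (tsum_pathWeight (lockInit k) (lockStep k) π)
  rw [← Finset.mul_sum, Finset.sum_eq_single ((z.1 (Fin.last k)).2 - (z.1 (Fin.last k)).1)]
  · simp [keySet]
  · intro i _ hi
    refine Set.indicator_of_notMem (fun h => hi ?_) _
    rw [eq_sub_iff_add_eq', ← show _ = _ from h]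
  · simp

theorem value_lockMDP {k : ℕ} (W : Set (LockState k)) (π : Policy k (LockState k) (Fin 2)) :
    (lockMDP k W).value π = (winProb W π).toReal := by
  rw [MDP.value, integral_eq_lintegral_of_nonneg_ae
    (Filter.Eventually.of_forall fun τ => Finset.sum_nonneg fun h _ => (τ h).2.2.2.1)
    measurable_totalReward.aestronglyMeasurable,
    MDP.lintegral_trajLaw_of_deterministic (ρ := lockReward W) (fun _ _ _ => rfl) π
      measurable_totalReward.ennreal_ofReal, winProb]
  congr 1
  refine tsum_congr fun z => ?_
  rw [totalReward_rewardedPath (lockReward_of_ne_last W), coe_lockReward_last]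
  rfl

/-- The policy that enters the digits of the sum of the code shown and the key `i`; the
action in the last layer, which has no effect, is `0`. -/
noncomputable def keyPolicy {k : ℕ} (i : Code k) : Policy k (LockState k) (Fin 2) :=
  Fin.snoc (α := fun _ => LockState k → PMF (Fin 2)) (fun h s => PMF.pure ((s.1 + i) h))
    fun _ => PMF.pure 0

theorem winProb_keyPolicy {k : ℕ} (i : Code k) : winProb (keySet i) (keyPolicy i) = 1 := by
  rw [← tsum_pathWeight (lockInit k) (lockStep k) (keyPolicy i), winProb]
  refine tsum_congr fun z => ?_
  by_cases hz : pathWeight (lockInit k) (lockStep k) (keyPolicy i) z = 0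
  · rw [hz, zero_mul]
  have hz' := hz
  simp only [pathWeight, mul_eq_zero, not_or, Finset.prod_eq_zero_iff, Finset.mem_univ, true_and,
    not_exists] at hz'
  obtain ⟨⟨-, hact⟩, hstep⟩ := hz'
  have hact' (h : Fin k) : z.2 h.castSucc = ((z.1 h.castSucc).1 + i) h := by
    have := hact h.castSucc
    rw [keyPolicy, Fin.snoc_castSucc] at this
    simpa [PMF.pure_apply] using this
  have hstep' (h : Fin k) : z.1 h.succ =
      ((z.1 h.castSucc).1, Function.update (z.1 h.castSucc).2 h (z.2 h.castSucc)) := by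
    simpa [lockStep, PMF.pure_apply] using hstep h
  -- After `h` layers the first `h` digits are the right ones.
  have key (h : Fin (k + 1)) : ∀ j : Fin k, j.castSucc < h →
      (z.1 h).2 j = ((z.1 h).1 + i) j := by
    induction h using Fin.induction with
    | zero => intro j hj; exact absurd hj (Fin.not_lt_zero _)
    | succ h ih =>
      intro j hj
      rw [hstep' h]
      rcases eq_or_ne j h with rfl | hne
      · simpa using hact' j
      · have hlt : j.castSucc < h.castSucc := by
          rw [Fin.lt_def] at hj ⊢
          simp only [Fin.val_castSucc, Fin.val_succ] at hj ⊢
          have := Fin.val_ne_of_ne hne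
          omega
        simpa [Function.update_of_ne hne] using ih j hlt
  rw [Set.indicator_of_mem, mul_one]
  exact funext fun j => key _ j (Fin.castSucc_lt_last j)

theorem risk_lockMDP {k : ℕ} (i : Code k) (π : Policy k (LockState k) (Fin 2)) :
    (lockMDP k (keySet i)).risk π = 1 - (winProb (keySet i) π).toReal := by
  have hle (π' : Policy k (LockState k) (Fin 2)) : (winProb (keySet i) π').toReal ≤ 1 :=
    ENNReal.toReal_le_of_le_ofReal zero_le_one (by simpa using winProb_le_one (keySet i) π')
  simp only [MDP.risk, value_lockMDP]
  congr 1
  have : Nonempty (Policy k (LockState k) (Fin 2)) := ⟨keyPolicy i⟩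
  refine le_antisymm (ciSup_le hle) ?_
  refine le_ciSup_of_le ⟨1, ?_⟩ (keyPolicy i) (by simp [winProb_keyPolicy])
  rintro _ ⟨π', rfl⟩
  exact hle π'

/-- Playing in the lock with winning set `W` is the same as playing in the lock without rewards, up
to the event of winning. -/
theorem lintegral_trajLaw_lockMDP_le {k : ℕ} (W : Set (LockState k))
    (π : Policy k (LockState k) (Fin 2)) (F : Traj k (LockState k) (Fin 2) → ℝ≥0∞)
    (hF : Measurable F) (h1 : ∀ τ, F τ ≤ 1) :
    ∫⁻ τ, F τ ∂(lockMDP k W).trajLaw π ≤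
      ∫⁻ τ, F τ ∂(lockMDP k ∅).trajLaw π + winProb W π := by
  rw [MDP.lintegral_trajLaw_of_deterministic (ρ := lockReward W) (fun _ _ _ => rfl) π hF,
    MDP.lintegral_trajLaw_of_deterministic (ρ := lockReward ∅) (fun _ _ _ => rfl) π hF, winProb,
    ← ENNReal.tsum_add]
  refine ENNReal.tsum_le_tsum fun z => ?_
  change pathWeight (lockInit k) (lockStep k) π z * _ ≤
    pathWeight (lockInit k) (lockStep k) π z * _ + _
  rw [← mul_add]
  gcongr
  by_cases hz : z.1 (Fin.last k) ∈ W
  · rw [Set.indicator_of_mem hz]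
    exact (h1 _).trans le_add_self
  · have e : rewardedPath (lockReward W) z = rewardedPath (lockReward ∅) z := by
      funext h
      have : ¬ (h = Fin.last k ∧ z.1 h ∈ W) := by rintro ⟨rfl, h⟩; exact hz h
      simp [rewardedPath, lockReward, this]
    rw [e]
    exact le_self_add

/-! ### Few episodes do not suffice -/

/-- An algorithm that succeeds on the locks with all `2 ^ k` keys needs a number of episodes that is
linear in `2 ^ k`: without rewards each episode, and the output, test one key on average. -/
theorem episodes_lower_bound {k T : ℕ} (hk : 2 ≤ k)
    (alg : Algorithm k (LockState k) (Fin 2) T)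
    (halg : ∀ i : Code k, ENNReal.ofReal (1 - 1 / 4) ≤
      alg.outputLaw (lockMDP k (keySet i)) {π | (lockMDP k (keySet i)).risk π ≤ 1 / 4}) :
    (2 : ℝ) ^ k / 4 ≤ T := by
  set M₀ := lockMDP k ∅
  -- The conditional probability, given the history, that the output policy tests the key `i`.
  let G (i : Code k) (η : History k (LockState k) (Fin 2) T) : ℝ≥0∞ :=
    ∫⁻ π, winProb (keySet i) π ∂alg.output η
  have hG (i) : Measurable (G i) := (measurable_winProb _).lintegral_kernel
  have hG1 (i η) : G i η ≤ 1 :=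
    (lintegral_mono fun π => winProb_le_one (keySet i) π).trans (by simp)
  have hlow (i : Code k) : ENNReal.ofReal (9 / 16) ≤
      ∫⁻ η, G i η ∂alg.historyLaw M₀ T +
        ∑ s ∈ Finset.range T, alg.selectMean M₀ (winProb (keySet i)) s := by
    refine le_trans ?_ (alg.lintegral_historyLaw_le (measurable_winProb (keySet i))
      (lintegral_trajLaw_lockMDP_le (keySet i)) T (G i) (hG i) (hG1 i))
    have e : ∫⁻ η, G i η ∂alg.historyLaw (lockMDP k (keySet i)) T =
        ∫⁻ π, winProb (keySet i) π ∂alg.outputLaw (lockMDP k (keySet i)) := by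
      rw [Algorithm.outputLaw, Measure.lintegral_bind alg.output.measurable.aemeasurable
        (measurable_winProb _).aemeasurable]
    rw [e]
    -- Markov's inequality: the risk is at most `1 / 4` only if the key is found with probability
    -- at least `3 / 4`.
    calc ENNReal.ofReal (9 / 16)
        = ENNReal.ofReal (1 - 1 / 4) * ENNReal.ofReal (1 - 1 / 4) := by
          rw [← ENNReal.ofReal_mul (by norm_num)]; norm_num
      _ ≤ ENNReal.ofReal (1 - 1 / 4) * alg.outputLaw (lockMDP k (keySet i))
            {π | ENNReal.ofReal (1 - 1 / 4) ≤ winProb (keySet i) π} := by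
          gcongr
          refine (halg i).trans (measure_mono fun π hπ => ?_)
          rw [Set.mem_ofPred_eq, risk_lockMDP] at hπ
          exact ENNReal.ofReal_le_of_le_toReal (by linarith)
      _ ≤ _ := mul_meas_ge_le_lintegral (measurable_winProb _) _
  have hsum : ∑ i : Code k, (∫⁻ η, G i η ∂alg.historyLaw M₀ T +
      ∑ s ∈ Finset.range T, alg.selectMean M₀ (winProb (keySet i)) s) = 1 + T := by
    rw [Finset.sum_add_distrib, Finset.sum_comm, ← lintegral_finsetSum _ fun i _ => hG i]
    congr 1
    · simp only [G]
      simp_rw [← lintegral_finsetSum _ fun i _ => measurable_winProb (keySet i),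
        sum_winProb_keySet]
      simp
    · have hs (s : ℕ) : ∑ i : Code k, alg.selectMean M₀ (winProb (keySet i)) s = 1 := by
        simp only [Algorithm.selectMean]
        rw [← lintegral_finsetSum _ fun i _ => (measurable_winProb (keySet i)).lintegral_kernel]
        simp_rw [← lintegral_finsetSum _ fun i _ => measurable_winProb (keySet i),
          sum_winProb_keySet]
        simp
      simp [hs]
  have hfin : ENNReal.ofReal ((2 : ℝ) ^ k * (9 / 16)) ≤ ENNReal.ofReal (1 + T) := by
    calc ENNReal.ofReal ((2 : ℝ) ^ k * (9 / 16))
        = ∑ _i : Code k, ENNReal.ofReal (9 / 16) := by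
          rw [Finset.sum_const, nsmul_eq_mul, ENNReal.ofReal_mul (by positivity)]
          simp
      _ ≤ 1 + T := hsum ▸ Finset.sum_le_sum fun i _ => hlow i
      _ = ENNReal.ofReal (1 + T) := by
          rw [ENNReal.ofReal_add zero_le_one (Nat.cast_nonneg T)]; simp
  rw [ENNReal.ofReal_le_ofReal_iff (by positivity)] at hfin
  have : (2 : ℝ) ^ 2 ≤ 2 ^ k := pow_le_pow_right₀ one_le_two hk
  linarith

/-! ### The locks as latent-dynamics MDPs -/

/-- The decoder that shifts the code shown by the key `i`. -/
def keyDecoder {k : ℕ} (i : Code k) (x : LockState k) : LockState k := (x.1 + i, x.2)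

/-- The deterministic emission process that inverts `keyDecoder i`. -/
noncomputable def keyEmission {k : ℕ} (i : Code k) : Emission k (LockState k) (LockState k) :=
  fun _ s => PMF.pure (s.1 - i, s.2)

theorem keyDecoder_injective {k : ℕ} : Function.Injective (keyDecoder (k := k)) := fun i j h => by
  simpa [keyDecoder] using congrFun h 0

theorem latentDynamics_keyEmission {k : ℕ} (i : Code k) :
    latentDynamics (lockMDP k (keySet 0)) (keyEmission i) (keyDecoder i) =
      lockMDP k (keySet i) := by
  have hinit : (lockInit k).bind (keyEmission i 0) = lockInit k := by
    -- The uniform distribution on codes is invariant under shifts.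
    have hshift : (PMF.uniformOfFintype (Code k)).map (fun r => r - i) =
        PMF.uniformOfFintype (Code k) := by
      ext r
      rw [PMF.map_apply, tsum_eq_single (r + i)]
      · simp
      · intro r' hr'
        exact if_neg fun h => hr' (by rw [h, sub_add_cancel])
    calc (lockInit k).bind (keyEmission i 0)
        = (lockInit k).map (fun s => (s.1 - i, s.2)) := PMF.bind_pure_comp _ _
      _ = ((PMF.uniformOfFintype (Code k)).map (fun r => r - i)).map (fun r => (r, 0)) := by
          rw [lockInit, PMF.map_comp, PMF.map_comp]; rfl
      _ = lockInit k := by rw [hshift, lockInit]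
  have hstep (h : Fin k) (x : LockState k) (a : Fin 2) :
      (lockStep k h (keyDecoder i x) a).bind (keyEmission i h.succ) = lockStep k h x a := by
    simp [lockStep, keyEmission, keyDecoder]
  have hreward (h : Fin (k + 1)) (x : LockState k) (a : Fin 2) :
      lockReward (keySet 0) h (keyDecoder i x) a = lockReward (keySet i) h x a := by
    have e : keyDecoder i x ∈ keySet 0 ↔ x ∈ keySet i := by simp [keySet, keyDecoder]
    by_cases hx : x ∈ keySet i <;> simp [lockReward, e, hx]
  simp only [latentDynamics, lockMDP, hinit, hstep, hreward]

theorem lockMDP_mem_latentDynamicsClass {k : ℕ} {Φ : Set (LockState k → LockState k)} (i : Code k)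
    (hi : keyDecoder i ∈ Φ) :
    lockMDP k (keySet i) ∈ latentDynamicsClass {lockMDP k (keySet 0)} Φ := by
  refine ⟨_, rfl, keyEmission i, ?_, keyDecoder i, hi, ?_, (latentDynamics_keyEmission i).symm⟩
  · intro h s s' hne
    rw [← Set.disjoint_iff_inter_eq_empty]
    simp only [keyEmission, PMF.support_pure, Set.disjoint_singleton]
    exact fun e => hne (by simpa [Prod.ext_iff, eq_comm] using e)
  · intro h s x hx
    rw [keyEmission, PMF.support_pure, Set.mem_singleton_iff] at hx
    simp [hx, keyDecoder]

theorem rewardsNormalized_lockMDP {k : ℕ} (W : Set (LockState k)) :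
    (lockMDP k W).RewardsNormalized :=
  MDP.rewardsNormalized_of_last (ρ := lockReward W) (fun _ _ _ => rfl) (lockReward_of_ne_last W)

theorem rewardsNormalized_of_mem_latentDynamicsClass {k : ℕ} {W : Set (LockState k)} {X : Type}
    [MeasurableSpace X] [Countable X] {Φ : Set (X → LockState k)} {M : MDP k X (Fin 2)}
    (hM : M ∈ latentDynamicsClass {lockMDP k W} Φ) : M.RewardsNormalized := by
  obtain ⟨_, rfl, ψ, -, φ, -, -, rfl⟩ := hM
  exact MDP.rewardsNormalized_of_last (ρ := fun h x a => lockReward W h (φ x) a)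
    (fun _ _ _ => rfl) fun h hh x a => lockReward_of_ne_last W h hh (φ x) a

/-- A single MDP with an optimal policy is learned without any interaction. -/
theorem sampleComplexity_singleton_eq_zero {L : ℕ} {X A : Type} [MeasurableSpace X]
    [MeasurableSpace A] [Countable X] [Countable A] {M : MDP L X A} {π : Policy L X A}
    (hπ : M.risk π ≤ 0) {ε δ : ℝ} (hε : 0 < ε) (hδ : 0 < δ) : sampleComplexity {M} ε δ = 0 := by
  refine le_antisymm (iInf₂_le_of_le 0 ⟨⟨fun _ => Kernel.const _ (Measure.dirac π),
    Kernel.const _ (Measure.dirac π), fun _ => inferInstance, inferInstance⟩, ?_⟩ le_rfl) zero_le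
  intro M' hM'
  have e : Measure.bind (Measure.dirac Fin.elim0)
      (Kernel.const (History L X A 0) (Measure.dirac π)) = Measure.dirac π := by
    change Measure.bind _ (fun _ => Measure.dirac π) = _
    rw [Measure.bind_const]; simp
  rw [Set.mem_singleton_iff.1 hM', Algorithm.outputLaw, Algorithm.historyLaw, e]
  refine le_trans ?_ Measure.le_dirac_apply
  rw [Set.indicator_of_mem (show π ∈ {π | M.risk π ≤ ε} from hπ.trans hε.le)]
  exact ENNReal.ofReal_le_one.2 (by linarith)

end LatentRL

/-! ### The choice of the key length -/

theorem mainTheorem1 :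
    ∃ c C κ : ℝ, 0 < c ∧ 0 < C ∧ 0 < κ ∧ ∀ N : ℕ, 4 ≤ N →
      ∃ (L : ℕ) (S X : Type) (_ : Fintype S) (_ : Fintype X)
        (_ : MeasurableSpace S) (_ : DiscreteMeasurableSpace S)
        (_ : MeasurableSpace X) (_ : DiscreteMeasurableSpace X)
        (Mlat : LatentRL.MDP L S (Fin 2)) (Φ : Set (X → S)),
        Φ.ncard = N ∧
        ((L + 1 : ℕ) : ℝ) ≤ C * Real.log N ∧
        Fintype.card S = Fintype.card X ∧ Fintype.card X ≤ N ^ 2 ∧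
        Mlat.RewardsNormalized ∧
        (∀ M ∈ LatentRL.latentDynamicsClass {Mlat} Φ, M.RewardsNormalized) ∧
        (∀ ε δ : ℝ, 0 < ε → 0 < δ → LatentRL.sampleComplexity {Mlat} ε δ = 0) ∧
        ENNReal.ofReal (κ * (N / Real.log N)) ≤
          (LatentRL.sampleComplexity (LatentRL.latentDynamicsClass {Mlat} Φ) c c : ℝ≥0∞) := by
  classical
  refine ⟨1 / 4, 3, 1 / 8, by norm_num, by norm_num, by norm_num, fun N hN => ?_⟩
  -- The keys are the words of length `k`, where `2 ^ k` is the largest power of two up to `N`.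
  obtain ⟨k, hk, hkN, hNk⟩ : ∃ k, 2 ≤ k ∧ 2 ^ k ≤ N ∧ N < 2 ^ (k + 1) :=
    ⟨Nat.log 2 N, Nat.le_log_of_pow_le one_lt_two hN, Nat.pow_log_le_self 2 (by omega),
      Nat.lt_pow_succ_log_self one_lt_two N⟩
  have hcard : Fintype.card (LatentRL.LockState k) = 2 ^ k * 2 ^ k := by simp
  have hcardN : Fintype.card (LatentRL.LockState k) ≤ N ^ 2 := by
    rw [hcard, sq]; exact Nat.mul_le_mul hkN hkN
  -- The decoders of the keys are filled up with arbitrary maps to a set of `N` decoders.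
  obtain ⟨Φ, hΦ, hΦN⟩ : ∃ Φ : Finset (LatentRL.LockState k → LatentRL.LockState k),
      Finset.univ.image LatentRL.keyDecoder ⊆ Φ ∧ Φ.card = N := by
    refine Finset.exists_superset_card_eq ?_ ?_
    · rw [Finset.card_image_of_injective _ LatentRL.keyDecoder_injective]
      simpa using hkN
    · have h1 : 1 < 2 ^ k := Nat.one_lt_two_pow (by omega)
      calc N ≤ 2 ^ k * 2 ^ k := by rw [pow_succ] at hNk; nlinarith
        _ = Fintype.card (LatentRL.LockState k) := hcard.symm
        _ ≤ Fintype.card (LatentRL.LockState k) ^ Fintype.card (LatentRL.LockState k) :=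
          Nat.le_self_pow Fintype.card_ne_zero _
        _ = Fintype.card (LatentRL.LockState k → LatentRL.LockState k) := by
          rw [Fintype.card_fun]
  have hN0 : (0 : ℝ) < N := by positivity
  have hlog2 : (0.6931471803 : ℝ) < Real.log 2 := Real.log_two_gt_d9
  have hlogk : k * Real.log 2 ≤ Real.log N := by
    rw [← Real.log_pow]
    exact Real.log_le_log (by positivity) (by exact_mod_cast hkN)
  have hk' : (2 : ℝ) ≤ k := by exact_mod_cast hk
  have hlogN : 1 ≤ Real.log N := by nlinarith
  refine ⟨k, LatentRL.LockState k, LatentRL.LockState k, inferInstance, inferInstance,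
    inferInstance, inferInstance, inferInstance, inferInstance,
    LatentRL.lockMDP k (LatentRL.keySet 0),
    (Φ : Set (LatentRL.LockState k → LatentRL.LockState k)), by rw [Set.ncard_coe_finset, hΦN], ?_, rfl, hcardN,
    LatentRL.rewardsNormalized_lockMDP _,
    fun M hM => LatentRL.rewardsNormalized_of_mem_latentDynamicsClass hM,
    fun ε δ hε hδ => LatentRL.sampleComplexity_singleton_eq_zero
      (π := LatentRL.keyPolicy 0) ?_ hε hδ, ?_⟩
  · push_cast; nlinarith
  · rw [LatentRL.risk_lockMDP, LatentRL.winProb_keyPolicy]; simp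
  · have hT : ((⌈1 / 8 * (N / Real.log N)⌉₊ : ℕ) : ℕ∞) ≤ LatentRL.sampleComplexity
        (LatentRL.latentDynamicsClass {LatentRL.lockMDP k (LatentRL.keySet 0)}
          (Φ : Set (LatentRL.LockState k → LatentRL.LockState k)))
        (1 / 4) (1 / 4) := by
      refine le_iInf₂ fun T ⟨alg, halg⟩ => ?_
      have hbound := LatentRL.episodes_lower_bound hk alg fun i => halg _
        (LatentRL.lockMDP_mem_latentDynamicsClass i
          (hΦ (Finset.mem_image_of_mem _ (Finset.mem_univ i))))
      have hNk' : (N : ℝ) ≤ 2 ^ k * 2 := by rw [← pow_succ]; exact_mod_cast hNk.le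
      have hdiv : (N : ℝ) / Real.log N ≤ N := div_le_self hN0.le hlogN
      refine Nat.cast_le.2 (Nat.ceil_le.2 ?_)
      linarith
    refine le_trans ?_ (ENat.toENNReal_le.2 hT)
    rw [ENat.toENNReal_coe, ← ENNReal.ofReal_natCast]
    exact ENNReal.ofReal_le_ofReal (Nat.le_ceil _)
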